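/- There is an absolute constant $C>0$ such that the following holds. Let $f:\mathbb{R}\to[0,\infty)$ be a log-concave probability density that is symmetric about $0$, i.e. $f(ax+by)\ge f(x)^{a}f(y)^{b}$ for all $x,y\in\mathbb{R}$ and $a,b\ge 0$ with $a+b=1$, and $f(-x)=f(x)$ for all $x\in\mathbb{R}$. Let $n\in\mathbb{N}$ and let $X=(X_1,\dots,X_n)$, where $X_1,\dots,X_n$ are i.i.d. real random variables with density $f$ with respect to Lebesgue measure. Then for all $\alpha,\beta\in\mathbb{R}^n$ with $\alpha\neq 0$, $$\mathbf{P}\{|\langle\alpha,X\rangle|\le|\langle\beta,X\rangle|\}\le C\,\frac{\|\beta\|}{\|\alpha\|},$$ where $\langle\alpha,X\rangle=\sum_{i=1}^n\alpha_iX_i$, $\langle\beta,X\rangle=\sum_{i=1}^n\beta_iX_i$ and $\|\cdot\|$ is the Euclidean norm. -/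

import Mathlib

open MeasureTheory ProbabilityTheory

/-- A function `f : ℝ → ℝ` is log-concave if it is nonnegative and
`f x ^ a * f y ^ b ≤ f (a x + b y)` for all `x, y` and all weights `a, b ≥ 0` with `a + b = 1`;
equivalently `f = exp (-φ)` with `φ : ℝ → (-∞, ∞]` convex. The value `0` is allowed. -/
def IsLogConcave (f : ℝ → ℝ) : Prop :=
  (∀ x, 0 ≤ f x) ∧
    ∀ x y a b : ℝ, 0 ≤ a → 0 ≤ b → a + b = 1 → f x ^ a * f y ^ b ≤ f (a * x + b * y)

/-! The event and the ratio `‖β‖ / ‖α‖` do not change when `X` is scaled, so the peak `f 0` may be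
taken to be `1`. Every symmetric log-concave density with peak `1` then has a second moment below an
absolute constant and a characteristic function of order `1 / (1 + |s|)`, again with an absolute
constant.

If `⟨β, X⟩` were independent of `⟨α, X⟩`, conditioning on it would suffice: `⟨α, X⟩` lies in an
interval of radius `t` with probability `O(t / ‖α‖)`, and `|⟨β, X⟩|` has mean `O(‖β‖)`
(`measureReal_abs_add_le_of_indepFun`, `integral_abs_sum_le`). The task is to create this
independence.

When `α` is spread out, its coordinates split into blocks `I`, `J`, each carrying a fixed share of
`‖α‖ ^ 2`. One of the blocks supplies at least half of `|⟨β, X⟩|`; conditioning on that block leaves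
the other free to anticoncentrate. Its anticoncentration comes from Esseen's inequality. Decay of
order `1 / |s|` is not integrable, so the block is split once more, and two factors of that order
give `1 / s ^ 2`.

When one coordinate of `α` dominates, that coordinate anticoncentrates because the density is
bounded, and its contribution to `⟨β, X⟩` is absorbed into `|⟨α, X⟩|` and the remaining coordinates.
-/

/-! ### Anticoncentration: random shifts and Esseen's inequality -/

/-- An anticoncentration bound for `A` transfers to random shifts and radii that depend on a random
variable `B` independent of `A`. -/
theorem measureReal_abs_add_le_of_indepFun {Ω E : Type*} [MeasurableSpace Ω] [MeasurableSpace E]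
    {P : Measure Ω} [IsProbabilityMeasure P] {A : Ω → ℝ} {B : Ω → E}
    (hA : AEMeasurable A P) (hB : AEMeasurable B P) (hAB : IndepFun A B P)
    {g h : E → ℝ} (hg : Measurable g) (hh : Measurable h) (h0 : ∀ x, 0 ≤ h x)
    (hint : Integrable (fun ω => h (B ω)) P) {L : ℝ} (hL0 : 0 ≤ L)
    (hL : ∀ u t : ℝ, 0 ≤ t → P.real {ω | |A ω + u| ≤ t} ≤ L * t) :
    P.real {ω | |A ω + g (B ω)| ≤ h (B ω)} ≤ L * ∫ ω, h (B ω) ∂P := by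
  have hprod := (indepFun_iff_map_prod_eq_prod_map_map hA hB).1 hAB
  have hpair : AEMeasurable (fun ω => (A ω, B ω)) P := hA.prodMk hB
  have : IsProbabilityMeasure (P.map A) := Measure.isProbabilityMeasure_map hA
  have : IsProbabilityMeasure (P.map B) := Measure.isProbabilityMeasure_map hB
  set S : Set (ℝ × E) := {p | |p.1 + g p.2| ≤ h p.2} with hS
  have hSm : MeasurableSet S := measurableSet_le (by fun_prop) (by fun_prop)
  have h1 : P {ω | |A ω + g (B ω)| ≤ h (B ω)} = (P.map fun ω => (A ω, B ω)) S := by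
    rw [Measure.map_apply_of_aemeasurable hpair hSm]; rfl
  have h2 : P {ω | |A ω + g (B ω)| ≤ h (B ω)} ≤ ENNReal.ofReal (L * ∫ ω, h (B ω) ∂P) := by
    rw [h1, hprod, Measure.prod_apply_symm hSm]
    calc ∫⁻ y, (P.map A) ((fun x => (x, y)) ⁻¹' S) ∂(P.map B)
        ≤ ∫⁻ y, ENNReal.ofReal (L * h y) ∂(P.map B) := by
          refine lintegral_mono fun y => ?_
          rw [Measure.map_apply_of_aemeasurable hA (hSm.preimage (by fun_prop))]
          have := hL (g y) (h y) (h0 y)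
          rw [← ofReal_measureReal]
          exact ENNReal.ofReal_le_ofReal this
      _ = ∫⁻ ω, ENNReal.ofReal (L * h (B ω)) ∂P :=
          lintegral_map' (by fun_prop) hB
      _ = ENNReal.ofReal (L * ∫ ω, h (B ω) ∂P) := by
          rw [← integral_const_mul, ofReal_integral_eq_lintegral_ofReal (hint.const_mul L)]
          exact ae_of_all _ fun ω => mul_nonneg hL0 (h0 _)
  exact ENNReal.toReal_le_of_le_ofReal
    (mul_nonneg hL0 (integral_nonneg fun ω => h0 _)) h2

/-- Parseval's relation for a probability measure and a centred Gaussian. -/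
theorem integral_exp_neg_sq_eq_integral_charFun {ν : Measure ℝ} [IsProbabilityMeasure ν]
    (v : NNReal) :
    ((∫ x, Real.exp (-(v * x ^ 2 / 2)) ∂ν : ℝ) : ℂ) = ∫ s, charFun ν s ∂(gaussianReal 0 v) := by
  have h1 : ∀ x : ℝ, ((Real.exp (-(v * x ^ 2 / 2)) : ℝ) : ℂ)
      = ∫ s, Complex.exp (x * s * Complex.I) ∂(gaussianReal 0 v) := by
    intro x
    rw [← charFun_apply_real, charFun_gaussianReal]
    push_cast
    congr 1
    ring
  rw [← integral_complex_ofReal]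
  simp_rw [h1, charFun_apply_real]
  rw [integral_integral_swap]
  · simp_rw [mul_comm]
  · refine Integrable.of_bound (C := 1) (by fun_prop) (ae_of_all _ fun p => ?_)
    simp only [Function.uncurry]
    rw [← Complex.ofReal_mul, Complex.norm_exp_ofReal_mul_I]

/-- Esseen's inequality: a measure with rapidly decaying characteristic function is
anticoncentrated. -/
theorem measureReal_abs_le_of_norm_charFun_le {ν : Measure ℝ} [IsProbabilityMeasure ν] {k : ℝ}
    (hk : 0 < k) (hν : ∀ s, ‖charFun ν s‖ ≤ (1 + (k * s) ^ 2)⁻¹) {t : ℝ} (ht : 0 < t) :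
    ν.real {x | |x| ≤ t} ≤ 8 / k * t := by
  -- The test function `exp (-v x² / 2)` has width `t`: it is at least `1 / 2` on `|x| ≤ t`. Its
  -- dual Gaussian has density at most `t`, which produces the factor `t`.
  set v : NNReal := ⟨(1 / t) ^ 2, by positivity⟩ with hv
  have hv' : (v : ℝ) = (1 / t) ^ 2 := rfl
  have hv0 : v ≠ 0 := by
    intro h
    have : (v : ℝ) = 0 := by rw [h]; rfl
    rw [hv'] at this
    have : 0 < (1 / t) ^ 2 := by positivity
    linarith
  have hint : Integrable (fun x => Real.exp (-(v * x ^ 2 / 2))) ν := by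
    refine Integrable.of_bound (C := 1) (by fun_prop) (ae_of_all _ fun x => ?_)
    rw [Real.norm_eq_abs, abs_of_pos (Real.exp_pos _), Real.exp_le_one_iff]
    have : 0 ≤ (v : ℝ) * x ^ 2 / 2 := by positivity
    linarith
  have hmk : ν.real {x | |x| ≤ t} ≤ 2 * ∫ x, Real.exp (-(v * x ^ 2 / 2)) ∂ν := by
    have hm := mul_meas_ge_le_integral_of_nonneg
      (ae_of_all ν fun x => (Real.exp_pos (-(v * x ^ 2 / 2))).le) hint (1 / 2)
    have hsub : {x : ℝ | |x| ≤ t} ⊆ {x | 1 / 2 ≤ Real.exp (-(v * x ^ 2 / 2))} := by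
      intro x hx
      simp only [Set.mem_ofPred_eq] at hx ⊢
      have h1 : (v : ℝ) * x ^ 2 ≤ 1 := by
        rw [hv', one_div, inv_pow, inv_mul_le_iff₀ (by positivity), mul_one]
        exact sq_le_sq' (by linarith [abs_le.1 hx]) (abs_le.1 hx).2
      have := Real.add_one_le_exp (-(v * x ^ 2 / 2))
      linarith
    have := measureReal_mono (μ := ν) hsub
    linarith
  have hI : Integrable (fun s : ℝ => (1 + (k * s) ^ 2)⁻¹) :=
    integrable_inv_one_add_sq.comp_mul_left' hk.ne'
  have hIv : ∫ s : ℝ, (1 + (k * s) ^ 2)⁻¹ = k⁻¹ * Real.pi := by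
    rw [Measure.integral_comp_mul_left (fun s : ℝ => (1 + s ^ 2)⁻¹) k, integral_univ_inv_one_add_sq,
      abs_of_pos (by positivity), smul_eq_mul]
  have hpdf : ∀ s, gaussianPDFReal 0 v s ≤ t := by
    intro s
    have h2 : t⁻¹ ≤ √(2 * Real.pi * v) := by
      apply Real.le_sqrt_of_sq_le
      rw [hv', one_div]
      have : 1 ≤ 2 * Real.pi := by linarith [Real.pi_gt_three]
      nlinarith [sq_nonneg t⁻¹]
    rw [gaussianPDFReal]
    calc _ ≤ (√(2 * Real.pi * v))⁻¹ * 1 := by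
          gcongr
          rw [Real.exp_le_one_iff, neg_div]
          have : 0 ≤ (s - 0) ^ 2 / (2 * (v : ℝ)) := by positivity
          linarith
      _ ≤ t := by
          rw [mul_one]
          exact inv_le_of_inv_le₀ ht h2
  have hG : ∫ x, Real.exp (-(v * x ^ 2 / 2)) ∂ν ≤ t * (k⁻¹ * Real.pi) := by
    have h3 : ∫ x, Real.exp (-(v * x ^ 2 / 2)) ∂ν
        = ‖∫ s, charFun ν s ∂(gaussianReal 0 v)‖ := by
      rw [← integral_exp_neg_sq_eq_integral_charFun, Complex.norm_real, Real.norm_eq_abs,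
        abs_of_nonneg (integral_nonneg fun x => (Real.exp_pos _).le)]
    rw [h3, integral_gaussianReal_eq_integral_smul hv0, ← hIv, ← integral_const_mul]
    refine norm_integral_le_of_norm_le (hI.const_mul t) (ae_of_all _ fun s => ?_)
    rw [norm_smul, Real.norm_eq_abs, abs_of_nonneg (gaussianPDFReal_nonneg 0 v s)]
    exact mul_le_mul (hpdf s) (hν s) (norm_nonneg _) ht.le
  calc _ ≤ 2 * (t * (k⁻¹ * Real.pi)) := hmk.trans (by linarith)
    _ ≤ 2 * (t * (k⁻¹ * 4)) := by gcongr; exact Real.pi_le_four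
    _ = 8 / k * t := by ring

/-- A shift multiplies the characteristic function by a unimodular factor, so Esseen's bound is
uniform in the centre. Radius `0` follows by letting the radius shrink. -/
theorem measureReal_abs_add_le_of_norm_charFun_le {Ω : Type*} [MeasurableSpace Ω] {P : Measure Ω}
    [IsProbabilityMeasure P] {A : Ω → ℝ} (hA : AEMeasurable A P) {k : ℝ} (hk : 0 < k)
    (hν : ∀ s, ‖charFun (P.map A) s‖ ≤ (1 + (k * s) ^ 2)⁻¹) (u : ℝ) {t : ℝ} (ht : 0 ≤ t) :
    P.real {ω | |A ω + u| ≤ t} ≤ 8 / k * t := by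
  have key : ∀ t : ℝ, 0 < t → P.real {ω | |A ω + u| ≤ t} ≤ 8 / k * t := by
    intro t ht
    have hA' : AEMeasurable (fun ω => A ω + u) P := hA.add_const u
    have : IsProbabilityMeasure (P.map fun ω => A ω + u) := Measure.isProbabilityMeasure_map hA'
    have hmap : P.map (fun ω => A ω + u) = (P.map A).map (· + u) :=
      (AEMeasurable.map_map_of_aemeasurable (g := (· + u)) (by fun_prop) hA).symm
    have h := measureReal_abs_le_of_norm_charFun_le (ν := P.map fun ω => A ω + u) hk (fun s => by
      rw [hmap, charFun_map_add_const, norm_mul, Complex.norm_exp_ofReal_mul_I, mul_one]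
      exact hν s) ht
    rwa [map_measureReal_apply_of_aemeasurable hA'
      (measurableSet_le (by fun_prop) (by fun_prop))] at h
  rcases ht.eq_or_lt with rfl | ht
  · rw [mul_zero]
    refine le_of_forall_pos_le_add fun ε hε => ?_
    have h := key (ε * k / 8) (by positivity)
    have h2 : 8 / k * (ε * k / 8) = ε := by field_simp
    rw [h2] at h
    rw [zero_add]
    refine (measureReal_mono fun ω hω => ?_).trans h
    simp only [Set.mem_ofPred_eq] at hω ⊢
    exact hω.trans (by positivity)
  · exact key t ht

/-! ### Moments of weighted sums and splitting of weights -/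

/-- The first absolute moment of a weighted sum of independent centred variables with second
moment at most `K`. -/
theorem integral_abs_sum_le {Ω ι : Type*} [MeasurableSpace Ω] {P : Measure Ω}
    [IsProbabilityMeasure P] {X : ι → Ω → ℝ} (hX : iIndepFun X P) (h2 : ∀ i, MemLp (X i) 2 P)
    (h0 : ∀ i, ∫ ω, X i ω ∂P = 0) {K : ℝ} (hK : ∀ i, ∫ ω, X i ω ^ 2 ∂P ≤ K)
    (b : ι → ℝ) (s : Finset ι) :
    ∫ ω, |∑ i ∈ s, b i * X i ω| ∂P ≤ √(K * ∑ i ∈ s, b i ^ 2) := by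
  have hm : ∀ i ∈ s, MemLp (fun ω => b i * X i ω) 2 P := fun i _ => (h2 i).const_mul _
  have hS : MemLp (fun ω => ∑ i ∈ s, b i * X i ω) 2 P := memLp_finsetSum s hm
  have hsum : (fun ω => ∑ i ∈ s, b i * X i ω) = ∑ i ∈ s, fun ω => b i * X i ω := by
    ext ω; simp
  have hzero : ∫ ω, ∑ i ∈ s, b i * X i ω ∂P = 0 := by
    rw [integral_finsetSum _ fun i hi => (hm i hi).integrable (by norm_num)]
    simp [integral_const_mul, h0]
  have hvar : variance (fun ω => ∑ i ∈ s, b i * X i ω) P ≤ K * ∑ i ∈ s, b i ^ 2 := by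
    rw [hsum, IndepFun.variance_sum hm, Finset.mul_sum]
    · refine Finset.sum_le_sum fun i _ => ?_
      rw [variance_const_mul, variance_eq_sub (h2 i), h0 i]
      have := hK i
      simp only [Pi.pow_apply]
      nlinarith [sq_nonneg (b i)]
    · intro i _ j _ hij
      exact (hX.indepFun hij).comp (φ := fun x => b i * x) (ψ := fun x => b j * x)
        (by fun_prop) (by fun_prop)
  -- Nonnegativity of this variance is the Cauchy-Schwarz bound of the first absolute moment by the
  -- second moment.
  have habs := variance_nonneg (fun ω => |∑ i ∈ s, b i * X i ω|) P
  rw [variance_eq_sub (X := fun ω => |∑ i ∈ s, b i * X i ω|) hS.norm] at habs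
  rw [variance_eq_sub hS, hzero] at hvar
  apply Real.le_sqrt_of_sq_le
  simp only [Pi.pow_apply, sq_abs] at habs hvar
  linarith

theorem one_add_sum_le_prod_one_add {ι : Type*} (s : Finset ι) {x : ι → ℝ} (hx : ∀ i, 0 ≤ x i) :
    1 + ∑ i ∈ s, x i ≤ ∏ i ∈ s, (1 + x i) := by
  classical
  induction s using Finset.induction_on with
  | empty => simp
  | insert i s hi ih =>
    rw [Finset.sum_insert hi, Finset.prod_insert hi]
    have := Finset.sum_nonneg fun j (_ : j ∈ s) => hx j
    nlinarith [hx i]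

/-- A finite family of small nonnegative numbers splits into two parts with large sums. -/
theorem exists_subset_sum_ge {ι : Type*} [DecidableEq ι] (s : Finset ι) {w : ι → ℝ} {a d : ℝ}
    (ha : 0 ≤ a) (hd0 : 0 ≤ d) (hd : ∀ i ∈ s, w i ≤ d) (hs : 2 * a + d ≤ ∑ i ∈ s, w i) :
    ∃ t ⊆ s, a ≤ ∑ i ∈ t, w i ∧ a ≤ ∑ i ∈ s \ t, w i := by
  -- Greedy choice: adding elements until the sum first reaches `a` overshoots by at most one
  -- weight, hence by at most `d`.
  have key : ∀ r : Finset ι, r ⊆ s → a ≤ ∑ i ∈ r, w i →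
      ∃ t ⊆ r, a ≤ ∑ i ∈ t, w i ∧ ∑ i ∈ t, w i ≤ a + d := by
    intro r
    induction r using Finset.induction_on with
    | empty =>
      intro _ h
      exact ⟨∅, subset_rfl, h, by simpa using add_nonneg ha hd0⟩
    | insert i r hi ih =>
      intro hr h
      rw [Finset.insert_subset_iff] at hr
      by_cases h' : a ≤ ∑ i ∈ r, w i
      · obtain ⟨t, ht, h⟩ := ih hr.2 h'
        exact ⟨t, ht.trans (Finset.subset_insert _ _), h⟩
      · refine ⟨insert i r, subset_rfl, h, ?_⟩
        rw [Finset.sum_insert hi]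
        linarith [hd i hr.1]
  obtain ⟨t, hts, h1, h2⟩ := key s subset_rfl (by linarith)
  refine ⟨t, hts, h1, ?_⟩
  have := Finset.sum_sdiff (f := w) hts
  linarith

/-! ### Comparison of two weighted sums of independent variables -/

section

variable {Ω ι : Type*} [MeasurableSpace Ω] {P : Measure Ω}
  {X : ι → Ω → ℝ} {μ : Measure ℝ}

/-- Decay of the characteristic function of a weighted sum whose weights split into two blocks of
comparable size. -/
theorem norm_charFun_sum_le (hX : iIndepFun X P) (hlaw : ∀ i, HasLaw (X i) μ P) {c : ℝ}
    (hc : 0 ≤ c) (hφ : ∀ s, ‖charFun μ s‖ ^ 2 ≤ (1 + c * s ^ 2)⁻¹)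
    [DecidableEq ι] (a : ι → ℝ) {I T : Finset ι} (hT : T ⊆ I) {k : ℝ}
    (h1 : k ^ 2 ≤ c * ∑ i ∈ T, a i ^ 2) (h2 : k ^ 2 ≤ c * ∑ i ∈ I \ T, a i ^ 2) (s : ℝ) :
    ‖charFun (P.map fun ω => ∑ i ∈ I, a i * X i ω) s‖ ≤ (1 + (k * s) ^ 2)⁻¹ := by
  have hind : iIndepFun (fun i ω => a i * X i ω) P :=
    hX.comp (fun i x => a i * x) fun i => by fun_prop
  have hprod : charFun (P.map fun ω => ∑ i ∈ I, a i * X i ω) s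
      = ∏ i ∈ I, charFun μ (a i * s) := by
    rw [(hind.restrict _).charFun_map_fun_finsetSum_eq_prod
      fun i _ => (hlaw i).aemeasurable.const_mul _, Finset.prod_apply]
    refine Finset.prod_congr rfl fun i _ => ?_
    rw [charFun_map_mul_comp (hlaw i).aemeasurable, (hlaw i).map_eq]
  have block : ∀ J : Finset ι, k ^ 2 ≤ c * ∑ i ∈ J, a i ^ 2 →
      1 + (k * s) ^ 2 ≤ ∏ i ∈ J, (1 + c * (a i * s) ^ 2) := by
    intro J hJ
    refine le_trans ?_ (one_add_sum_le_prod_one_add J fun i => by positivity)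
    have : ∑ i ∈ J, c * (a i * s) ^ 2 = (c * ∑ i ∈ J, a i ^ 2) * s ^ 2 := by
      rw [Finset.mul_sum, Finset.sum_mul]
      exact Finset.sum_congr rfl fun i _ => by ring
    rw [this, mul_pow]
    gcongr
  have hk : 0 < 1 + (k * s) ^ 2 := by positivity
  rw [hprod, norm_prod]
  -- The hypothesis bounds squares, so the product over each block gives one factor `(1 + (k s)²)⁻¹`
  -- for the squared norm. Two blocks give its square, and the root is integrable in `s`.
  refine le_of_sq_le_sq ?_ (by positivity)
  rw [← Finset.prod_pow]
  calc ∏ i ∈ I, ‖charFun μ (a i * s)‖ ^ 2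
      ≤ ∏ i ∈ I, (1 + c * (a i * s) ^ 2)⁻¹ :=
        Finset.prod_le_prod (fun i _ => by positivity) fun i _ => hφ _
    _ = ((∏ i ∈ I \ T, (1 + c * (a i * s) ^ 2)) * ∏ i ∈ T, (1 + c * (a i * s) ^ 2))⁻¹ := by
        rw [Finset.prod_inv_distrib, Finset.prod_sdiff hT]
    _ ≤ ((1 + (k * s) ^ 2) * (1 + (k * s) ^ 2))⁻¹ := by
        gcongr
        · exact block _ h2
        · exact block _ h1
    _ = ((1 + (k * s) ^ 2)⁻¹) ^ 2 := by rw [← sq, inv_pow]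

theorem indepFun_sum_prodMk_sum (hX : iIndepFun X P) (hm : ∀ i, AEMeasurable (X i) P)
    {I J : Finset ι} (hIJ : Disjoint I J) (a b : ι → ℝ) :
    IndepFun (fun ω => ∑ i ∈ I, a i * X i ω)
      (fun ω => (∑ i ∈ J, a i * X i ω, ∑ i ∈ J, b i * X i ω)) P := by
  have h := (hX.indepFun_finset₀ I J hIJ hm).comp
    (φ := fun x : I → ℝ => ∑ i : I, a i * x i)
    (ψ := fun x : J → ℝ => (∑ i : J, a i * x i, ∑ i : J, b i * x i))
    (by fun_prop) (by fun_prop)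
  convert h using 1
  · ext ω
    exact (Finset.sum_coe_sort I fun i => a i * X i ω).symm
  · ext ω
    · exact (Finset.sum_coe_sort J fun i => a i * X i ω).symm
    · exact (Finset.sum_coe_sort J fun i => b i * X i ω).symm

variable [IsProbabilityMeasure P]

/-- Conditioning on the block `J` fixes both the shift and the radius. The term with `p` is needed
only for a dominant coordinate. -/
theorem measureReal_abs_sum_add_sum_le (hX : iIndepFun X P) (hm2 : ∀ i, MemLp (X i) 2 P)
    (h0 : ∀ i, ∫ ω, X i ω ∂P = 0) {K : ℝ} (hK : ∀ i, ∫ ω, X i ω ^ 2 ∂P ≤ K)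
    (a b : ι → ℝ) {I J : Finset ι} (hIJ : Disjoint I J) {L : ℝ} (hL0 : 0 ≤ L)
    (hL : ∀ u t : ℝ, 0 ≤ t → P.real {ω | |∑ i ∈ I, a i * X i ω + u| ≤ t} ≤ L * t)
    {p q : ℝ} (hp : 0 ≤ p) (hq : 0 ≤ q) :
    P.real {ω | |∑ i ∈ I, a i * X i ω + ∑ i ∈ J, a i * X i ω|
        ≤ p * |∑ i ∈ J, a i * X i ω| + q * |∑ i ∈ J, b i * X i ω|}
      ≤ L * (p * √(K * ∑ i ∈ J, a i ^ 2) + q * √(K * ∑ i ∈ J, b i ^ 2)) := by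
  have hm : ∀ i, AEMeasurable (X i) P := fun i => (hm2 i).aemeasurable
  have hint : ∀ b : ι → ℝ, Integrable (fun ω => |∑ i ∈ J, b i * X i ω|) P := fun b =>
    (integrable_finsetSum J fun i _ => ((hm2 i).integrable (by norm_num)).const_mul (b i)).abs
  have h := measureReal_abs_add_le_of_indepFun
    (Finset.aemeasurable_fun_sum I fun i _ => (hm i).const_mul (a i))
    ((Finset.aemeasurable_fun_sum J fun i _ => (hm i).const_mul (a i)).prodMk
      (Finset.aemeasurable_fun_sum J fun i _ => (hm i).const_mul (b i)))
    (indepFun_sum_prodMk_sum hX hm hIJ a b) (g := fun x : ℝ × ℝ => x.1)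
    (h := fun x : ℝ × ℝ => p * |x.1| + q * |x.2|) (by fun_prop) (by fun_prop)
    (fun x => by positivity) (((hint a).const_mul p).add ((hint b).const_mul q)) hL0 hL
  refine h.trans ?_
  simp only
  rw [integral_add ((hint a).const_mul p) ((hint b).const_mul q), integral_const_mul,
    integral_const_mul]
  have ha := integral_abs_sum_le hX hm2 h0 hK a J
  have hb := integral_abs_sum_le hX hm2 h0 hK b J
  gcongr

/-- The comparison inequality when the weights `a` have one dominant coordinate. -/
theorem measureReal_abs_sum_le_abs_sum_of_dominant [Fintype ι] [DecidableEq ι] (hX : iIndepFun X P)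
    (hm2 : ∀ i, MemLp (X i) 2 P) (h0 : ∀ i, ∫ ω, X i ω ∂P = 0) {K : ℝ}
    (hK : ∀ i, ∫ ω, X i ω ^ 2 ∂P ≤ K ^ 2) (hK0 : 0 ≤ K)
    (hac : ∀ i, ∀ u t : ℝ, 0 ≤ t → P.real {ω | |X i ω + u| ≤ t} ≤ 2 * t)
    (a b : ι → ℝ) {A B : ℝ} (hA : 0 < A) (hB : 0 ≤ B) (hBA : B ≤ A / 4)
    (haA : ∑ i, a i ^ 2 ≤ A ^ 2) (hbB : ∑ i, b i ^ 2 ≤ B ^ 2) {i₀ : ι} (hi : A / 2 ≤ |a i₀|) :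
    P.real {ω | |∑ i, a i * X i ω| ≤ |∑ i, b i * X i ω|} ≤ 24 * K * (B / A) := by
  set J : Finset ι := Finset.univ.erase i₀ with hJ
  have hsplit : ∀ w : ι → ℝ, ∑ i, w i = w i₀ + ∑ i ∈ J, w i := fun w =>
    (Finset.add_sum_erase _ w (Finset.mem_univ i₀)).symm
  have ha0 : 0 < |a i₀| := by linarith
  have hb0 : |b i₀| ≤ B := by
    refine abs_le_of_sq_le_sq ?_ hB
    exact (Finset.single_le_sum (f := fun i => b i ^ 2) (fun i _ => sq_nonneg _)
      (Finset.mem_univ i₀)).trans hbB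
  have hL : ∀ u t : ℝ, 0 ≤ t →
      P.real {ω | |∑ i ∈ {i₀}, a i * X i ω + u| ≤ t} ≤ 4 / A * t := by
    intro u t ht
    have h := hac i₀ (u / a i₀) (t / |a i₀|) (by positivity)
    have hset : {ω | |∑ i ∈ {i₀}, a i * X i ω + u| ≤ t}
        = {ω | |X i₀ ω + u / a i₀| ≤ t / |a i₀|} := by
      ext ω
      simp only [Finset.sum_singleton, Set.mem_ofPred_eq]
      rw [le_div_iff₀ ha0, ← abs_mul]
      have : (X i₀ ω + u / a i₀) * a i₀ = a i₀ * X i₀ ω + u := by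
        have := abs_pos.1 ha0
        field_simp
      rw [this]
    rw [hset]
    refine h.trans ?_
    calc 2 * (t / |a i₀|) ≤ 2 * (t / (A / 2)) := by gcongr
      _ = 4 / A * t := by field_simp; ring
  have hdis : Disjoint {i₀} J := by simp [hJ]
  -- With `x` the dominant term and `u` the rest of the `a`-sum, `|b i₀ * X i₀| ≤ 2 (B / A) |x| ≤ 2
  -- (B / A) (|x + u| + |u|)`. Since `B / A ≤ 1 / 4`, at most half of `|x + u|` appears on the
  -- right; absorbing it doubles the other terms, whence `p` and `q`.
  have hmain := measureReal_abs_sum_add_sum_le hX hm2 h0 hK a b hdis (by positivity) hL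
    (p := 4 * (B / A)) (q := 2) (by positivity) (by norm_num)
  have hsub : {ω | |∑ i, a i * X i ω| ≤ |∑ i, b i * X i ω|} ⊆
      {ω | |∑ i ∈ {i₀}, a i * X i ω + ∑ i ∈ J, a i * X i ω|
        ≤ 4 * (B / A) * |∑ i ∈ J, a i * X i ω| + 2 * |∑ i ∈ J, b i * X i ω|} := by
    intro ω hω
    simp only [Set.mem_ofPred_eq, Finset.sum_singleton] at hω ⊢
    rw [hsplit fun i => a i * X i ω, hsplit fun i => b i * X i ω] at hω
    set x := a i₀ * X i₀ ω
    set u := ∑ i ∈ J, a i * X i ω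
    set v := ∑ i ∈ J, b i * X i ω
    have h1 : |b i₀ * X i₀ ω| ≤ 2 * (B / A) * |x| := by
      rw [abs_mul, abs_mul]
      have : 2 * (B / A) * (|a i₀| * |X i₀ ω|) = (2 * (B / A) * |a i₀|) * |X i₀ ω| := by ring
      rw [this]
      gcongr
      calc |b i₀| ≤ B := hb0
        _ = 2 * (B / A) * (A / 2) := by field_simp
        _ ≤ _ := by gcongr
    have h2 := abs_add_le (b i₀ * X i₀ ω) v
    have h3 : |x| ≤ |x + u| + |u| := by
      have := abs_sub (x + u) u
      simpa using this
    have h4 : B / A ≤ 1 / 4 := by rw [div_le_iff₀ hA]; linarith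
    have h5 : 0 ≤ B / A := by positivity
    have h6 : 2 * (B / A) * |x| ≤ 2 * (B / A) * (|x + u| + |u|) := by gcongr
    have h7 : 2 * (B / A) * |x + u| ≤ 1 / 2 * |x + u| := by gcongr; linarith
    linarith
  have hsumJ : ∀ w : ι → ℝ, ∑ i ∈ J, w i ^ 2 ≤ ∑ i, w i ^ 2 := fun w =>
    Finset.sum_le_sum_of_subset_of_nonneg (Finset.subset_univ _) fun i _ _ => sq_nonneg _
  have hs : ∀ (w : ι → ℝ) {W : ℝ}, 0 ≤ W → ∑ i, w i ^ 2 ≤ W ^ 2 →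
      √(K ^ 2 * ∑ i ∈ J, w i ^ 2) ≤ K * W := by
    intro w W hW h
    rw [Real.sqrt_le_left (by positivity), mul_pow]
    gcongr
    exact (hsumJ w).trans h
  refine (measureReal_mono hsub).trans (hmain.trans ?_)
  calc _ ≤ 4 / A * (4 * (B / A) * (K * A) + 2 * (K * B)) := by
        gcongr
        · exact hs a hA.le haA
        · exact hs b hB hbB
    _ = 24 * K * (B / A) := by field_simp; ring

/-- The comparison inequality when no coordinate of `a` is dominant. -/
theorem measureReal_abs_sum_le_abs_sum_of_spread [Fintype ι] [DecidableEq ι] (hX : iIndepFun X P)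
    (hlaw : ∀ i, HasLaw (X i) μ P)
    (hm2 : ∀ i, MemLp (X i) 2 P) (h0 : ∀ i, ∫ ω, X i ω ∂P = 0) {K : ℝ}
    (hK : ∀ i, ∫ ω, X i ω ^ 2 ∂P ≤ K ^ 2) (hK0 : 0 ≤ K) {c : ℝ} (hc : 0 < c)
    (hφ : ∀ s, ‖charFun μ s‖ ^ 2 ≤ (1 + (c * s) ^ 2)⁻¹)
    (a b : ι → ℝ) {A B : ℝ} (hA : 0 < A) (hB : 0 ≤ B)
    (haA : ∑ i, a i ^ 2 = A ^ 2) (hbB : ∑ i, b i ^ 2 ≤ B ^ 2) (hi : ∀ i, a i ^ 2 ≤ A ^ 2 / 4) :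
    P.real {ω | |∑ i, a i * X i ω| ≤ |∑ i, b i * X i ω|} ≤ 128 * K / c * (B / A) := by
  -- The shares fit exactly: `2 * 3/8 + 1/4 = 1` here, and `2 * 1/16 + 1/4 = 3/8` when a block is
  -- split again below.
  obtain ⟨I, -, hI, hI'⟩ := exists_subset_sum_ge Finset.univ (w := fun i => a i ^ 2)
    (a := 3 / 8 * A ^ 2) (d := A ^ 2 / 4) (by positivity) (by positivity) (fun i _ => hi i)
    (by rw [haA]; linarith)
  set J : Finset ι := Finset.univ \ I with hJ
  have hIJ : Disjoint I J := Finset.disjoint_sdiff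
  have hsplit : ∀ w : ι → ℝ, ∑ i, w i = ∑ i ∈ I, w i + ∑ i ∈ J, w i := fun w => by
    rw [add_comm]
    exact (Finset.sum_sdiff (Finset.subset_univ I)).symm
  have hL : ∀ S : Finset ι, 3 / 8 * A ^ 2 ≤ ∑ i ∈ S, a i ^ 2 → ∀ u t : ℝ, 0 ≤ t →
      P.real {ω | |∑ i ∈ S, a i * X i ω + u| ≤ t} ≤ 8 / (c * A / 4) * t := by
    intro S hS u t ht
    obtain ⟨T, hT, hT1, hT2⟩ := exists_subset_sum_ge S (w := fun i => a i ^ 2)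
      (a := A ^ 2 / 16) (d := A ^ 2 / 4) (by positivity) (by positivity) (fun i _ => hi i)
      (by linarith)
    refine measureReal_abs_add_le_of_norm_charFun_le
      (Finset.aemeasurable_fun_sum S fun i _ => (hlaw i).aemeasurable.const_mul (a i))
      (by positivity) (fun s => ?_) u ht
    have hk : (c * A / 4) ^ 2 = c ^ 2 * (A ^ 2 / 16) := by ring
    refine norm_charFun_sum_le hX hlaw (sq_nonneg c) (fun s => ?_) a hT ?_ ?_ s
    · rw [← mul_pow]; exact hφ s
    · rw [hk]; gcongr
    · rw [hk]; gcongr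
  have hhalf : ∀ S S' : Finset ι, Disjoint S S' → 3 / 8 * A ^ 2 ≤ ∑ i ∈ S, a i ^ 2 →
      P.real {ω | |∑ i ∈ S, a i * X i ω + ∑ i ∈ S', a i * X i ω|
        ≤ 0 * |∑ i ∈ S', a i * X i ω| + 2 * |∑ i ∈ S', b i * X i ω|} ≤ 64 * K / c * (B / A) := by
    intro S S' hd hS
    refine (measureReal_abs_sum_add_sum_le hX hm2 h0 hK a b hd (by positivity) (hL S hS)
      le_rfl (by norm_num)).trans ?_
    have hsq : √(K ^ 2 * ∑ i ∈ S', b i ^ 2) ≤ K * B := by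
      rw [Real.sqrt_le_left (by positivity), mul_pow]
      gcongr
      exact (Finset.sum_le_sum_of_subset_of_nonneg (Finset.subset_univ _)
        fun i _ _ => sq_nonneg _).trans hbB
    calc _ ≤ 8 / (c * A / 4) * (0 + 2 * (K * B)) := by
          rw [zero_mul]; gcongr
      _ = 64 * K / c * (B / A) := by field_simp; ring
  -- One of the two parts of the `b`-sum has at least half the absolute value of the whole.
  have hsub : {ω | |∑ i, a i * X i ω| ≤ |∑ i, b i * X i ω|} ⊆
      {ω | |∑ i ∈ I, a i * X i ω + ∑ i ∈ J, a i * X i ω|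
        ≤ 0 * |∑ i ∈ J, a i * X i ω| + 2 * |∑ i ∈ J, b i * X i ω|} ∪
      {ω | |∑ i ∈ J, a i * X i ω + ∑ i ∈ I, a i * X i ω|
        ≤ 0 * |∑ i ∈ I, a i * X i ω| + 2 * |∑ i ∈ I, b i * X i ω|} := by
    intro ω hω
    simp only [Set.mem_union, Set.mem_ofPred_eq, zero_mul, zero_add] at hω ⊢
    rw [hsplit fun i => a i * X i ω, hsplit fun i => b i * X i ω] at hω
    rw [add_comm (∑ i ∈ J, a i * X i ω)]
    have := abs_add_le (∑ i ∈ I, b i * X i ω) (∑ i ∈ J, b i * X i ω)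
    by_contra! hcon
    linarith [hcon.1, hcon.2]
  refine (measureReal_mono hsub).trans ((measureReal_union_le _ _).trans ?_)
  have e1 := hhalf I J hIJ hI
  have e2 := hhalf J I hIJ.symm hI'
  calc _ ≤ 64 * K / c * (B / A) + 64 * K / c * (B / A) := add_le_add e1 e2
    _ = 128 * K / c * (B / A) := by ring

/-- The comparison inequality for independent variables with a common law `μ` that is centred, has
bounded second moment, bounded density and a characteristic function of order `1 / (1 + |s|)`. -/
theorem measureReal_abs_sum_le_abs_sum [Fintype ι] (hX : iIndepFun X P)
    (hlaw : ∀ i, HasLaw (X i) μ P)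
    (hm2 : MemLp id 2 μ) (h0 : ∫ x, x ∂μ = 0) {K : ℝ}
    (hK : ∫ x, x ^ 2 ∂μ ≤ K ^ 2) (hK0 : 0 ≤ K)
    (hac : ∀ u t : ℝ, 0 ≤ t → μ.real {x | |x + u| ≤ t} ≤ 2 * t) {c : ℝ} (hc : 0 < c)
    (hφ : ∀ s, ‖charFun μ s‖ ^ 2 ≤ (1 + (c * s) ^ 2)⁻¹)
    (α β : EuclideanSpace ℝ ι) (hα : α ≠ 0) :
    P.real {ω | |∑ i, α i * X i ω| ≤ |∑ i, β i * X i ω|}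
      ≤ (4 + 24 * K + 128 * K / c) * (‖β‖ / ‖α‖) := by
  classical
  have hA : 0 < ‖α‖ := norm_pos_iff.2 hα
  have hr : 0 ≤ ‖β‖ / ‖α‖ := by positivity
  have hk1 : 0 ≤ 24 * K := by positivity
  have hk2 : 0 ≤ 128 * K / c := by positivity
  -- For `‖β‖ > ‖α‖ / 4` the summand `4` of the constant already makes the right side at least `1`.
  rcases lt_or_ge (‖α‖ / 4) ‖β‖ with hBA | hBA
  · have h1 : P.real {ω | |∑ i, α i * X i ω| ≤ |∑ i, β i * X i ω|} ≤ 1 := measureReal_le_one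
    have h2 : 1 / 4 ≤ ‖β‖ / ‖α‖ := by rw [le_div_iff₀ hA]; linarith
    nlinarith
  have hsqα : ∑ i, α i ^ 2 = ‖α‖ ^ 2 := (EuclideanSpace.real_norm_sq_eq α).symm
  have hsqβ : ∑ i, β i ^ 2 = ‖β‖ ^ 2 := (EuclideanSpace.real_norm_sq_eq β).symm
  have hm2' : ∀ i, MemLp (X i) 2 P := fun i => by
    have := (hlaw i).map_eq ▸ hm2
    exact this.comp_of_map (hlaw i).aemeasurable
  have h0' : ∀ i, ∫ ω, X i ω ∂P = 0 := fun i => by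
    rw [(hlaw i).integral_eq]; exact h0
  have hK' : ∀ i, ∫ ω, X i ω ^ 2 ∂P ≤ K ^ 2 := fun i =>
    ((hlaw i).integral_comp (f := fun x => x ^ 2) (by fun_prop)).trans_le hK
  by_cases hdom : ∃ i, ‖α‖ / 2 ≤ |α i|
  · obtain ⟨i₀, hi⟩ := hdom
    refine (measureReal_abs_sum_le_abs_sum_of_dominant hX hm2' h0' hK' hK0 (fun i u t ht => ?_)
      (fun i => α i) (fun i => β i) hA (norm_nonneg β) hBA hsqα.le hsqβ.le hi).trans ?_
    · rw [(hlaw i).measureReal_eq (p := fun x => |x + u| ≤ t)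
        (measurableSet_le (by fun_prop) (by fun_prop))]
      exact hac u t ht
    · gcongr; linarith
  · push Not at hdom
    refine (measureReal_abs_sum_le_abs_sum_of_spread hX hlaw hm2' h0' hK' hK0 hc hφ
      (fun i => α i) (fun i => β i) hA (norm_nonneg β) hsqα hsqβ.le fun i => ?_).trans ?_
    · rw [← sq_abs]
      nlinarith [hdom i, abs_nonneg (α i)]
    · gcongr; linarith

end

/-! ### Symmetric log-concave functions -/

namespace IsLogConcave

variable {f : ℝ → ℝ}

theorem le_apply_zero (hf : IsLogConcave f) (hs : ∀ x, f (-x) = f x) (x : ℝ) : f x ≤ f 0 := by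
  have h := hf.2 x (-x) (1 / 2) (1 / 2) (by norm_num) (by norm_num) (by norm_num)
  rw [hs, ← Real.sqrt_eq_rpow, Real.mul_self_sqrt (hf.1 x)] at h
  convert h using 2
  ring

/-- Up to sign, `y` is a convex combination of `x` and `0`, and the value at `0` is the largest. -/
theorem apply_le_of_abs_le (hf : IsLogConcave f) (hs : ∀ x, f (-x) = f x) {x y : ℝ}
    (hxy : |y| ≤ |x|) : f x ≤ f y := by
  have habs : ∀ z, f |z| = f z := fun z => by
    rcases abs_choice z with h | h <;> rw [h]
    exact hs z
  rw [← habs x, ← habs y]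
  generalize |x| = a at hxy
  have hy := abs_nonneg y
  generalize |y| = b at hxy hy
  rcases (hf.1 a).eq_or_lt with h0 | h0
  · rw [← h0]; exact hf.1 b
  rcases (hy.trans hxy).eq_or_lt with ha | ha
  · rw [← ha] at hxy
    rw [← ha, le_antisymm hxy hy]
  have hba : b / a ≤ 1 := (div_le_one ha).2 hxy
  have h := hf.2 a 0 (b / a) (1 - b / a) (by positivity) (by linarith) (by ring)
  have e : b / a * a + (1 - b / a) * 0 = b := by field_simp; ring
  rw [e] at h
  refine le_trans ?_ h
  calc f a = f a ^ (b / a) * f a ^ (1 - b / a) := by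
        rw [← Real.rpow_add h0]; simp
    _ ≤ _ := by
        gcongr
        · exact hf.le_apply_zero hs a

theorem measurable (hf : IsLogConcave f) (hs : ∀ x, f (-x) = f x) : Measurable f := by
  have hanti : Antitone fun y : ℝ => f (max y 0) := fun x y hxy => by
    apply hf.apply_le_of_abs_le hs
    rw [abs_of_nonneg (le_max_right x 0), abs_of_nonneg (le_max_right y 0)]
    exact max_le_max_right 0 hxy
  have h : f = (fun y : ℝ => f (max y 0)) ∘ abs := by
    ext x
    simp only [Function.comp, max_eq_left (abs_nonneg x)]
    rcases abs_choice x with h | h <;> rw [h]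
    exact (hs x).symm
  rw [h]
  exact hanti.measurable.comp measurable_id.abs

/-- A log-concave function with `f 0 = 1` and `f 1 ≤ 1 / 2` decays exponentially. -/
theorem le_two_mul_exp (hf : IsLogConcave f) (hs : ∀ x, f (-x) = f x) (h0 : f 0 = 1)
    (h1 : f 1 ≤ 1 / 2) (x : ℝ) : f x ≤ 2 * Real.exp (-(|x| / 2)) := by
  have habs : f |x| = f x := by
    rcases abs_choice x with h | h <;> rw [h]
    exact hs x
  rw [← habs]
  have hx := abs_nonneg x
  generalize |x| = y at hx
  have hlog : (1 / 2 : ℝ) ≤ Real.exp (-(1 / 2)) := by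
    have := Real.add_one_le_exp (-(1 / 2) : ℝ)
    linarith
  rcases le_or_gt y 1 with hy | hy
  · have e1 : f y ≤ 1 := h0 ▸ hf.le_apply_zero hs y
    have e2 : Real.exp (-(1 / 2)) ≤ Real.exp (-(y / 2)) := Real.exp_le_exp.2 (by linarith)
    linarith
  · have hy0 : 0 < y := by linarith
    have hy1 : 1 / y ≤ 1 := (div_le_one hy0).2 hy.le
    have h := hf.2 y 0 (1 / y) (1 - 1 / y) (by positivity) (by linarith) (by ring)
    have e : 1 / y * y + (1 - 1 / y) * 0 = 1 := by field_simp; ring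
    rw [e, h0, Real.one_rpow, mul_one] at h
    have e3 : f y = (f y ^ (1 / y)) ^ y := by
      rw [← Real.rpow_mul (hf.1 y), one_div_mul_cancel hy0.ne', Real.rpow_one]
    have e4 : f y ≤ Real.exp (-(1 / 2)) ^ y := by
      rw [e3]
      exact Real.rpow_le_rpow (Real.rpow_nonneg (hf.1 y) _) (h.trans (h1.trans hlog)) hy0.le
    rw [← Real.exp_mul] at e4
    have e5 : -(1 / 2) * y = -(y / 2) := by ring
    rw [e5] at e4
    linarith [Real.exp_pos (-(y / 2))]

/-- The exponential decay beats any polynomial; this majorant is chosen because its integral is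
explicit, `784 * π`. -/
theorem sq_mul_le (hf : IsLogConcave f) (hs : ∀ x, f (-x) = f x) (h0 : f 0 = 1)
    (h1 : f 1 ≤ 1 / 2) (x : ℝ) : x ^ 2 * f x ≤ 784 * (1 + x ^ 2)⁻¹ := by
  have hfx := hf.le_two_mul_exp hs h0 h1 x
  have hy : 0 ≤ |x| / 2 := by positivity
  have e2 := Real.pow_div_factorial_le_exp (|x| / 2) hy 2
  have e4 := Real.pow_div_factorial_le_exp (|x| / 2) hy 4
  have hsq : |x| ^ 2 = x ^ 2 := sq_abs x
  have hq : |x| ^ 4 = x ^ 4 := by rw [show 4 = 2 * 2 by norm_num, pow_mul, pow_mul, hsq]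
  rw [div_pow, hsq] at e2
  rw [div_pow, hq] at e4
  norm_num [Nat.factorial] at e2 e4
  have hmul : Real.exp (|x| / 2) * Real.exp (-(|x| / 2)) = 1 := by
    rw [← Real.exp_add]; simp
  have hpoly : x ^ 2 + x ^ 4 ≤ 392 * Real.exp (|x| / 2) := by linarith
  rw [← div_eq_mul_inv, le_div_iff₀ (by positivity)]
  calc x ^ 2 * f x * (1 + x ^ 2) = (x ^ 2 + x ^ 4) * f x := by ring
    _ ≤ (392 * Real.exp (|x| / 2)) * (2 * Real.exp (-(|x| / 2))) := by
        gcongr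
        exact hf.1 x
    _ = 784 := by linear_combination 784 * hmul

end IsLogConcave

/-! ### Densities with peak one: moments and high frequencies -/

/-- `f` is a symmetric log-concave probability density with `f 0 = 1`. -/
structure IsUnitPeakDensity (f : ℝ → ℝ) : Prop where
  logConcave : IsLogConcave f
  symm : ∀ x, f (-x) = f x
  apply_zero : f 0 = 1
  integrable : Integrable f
  integral_eq_one : ∫ x, f x = 1

namespace IsUnitPeakDensity

variable {f : ℝ → ℝ}

theorem nonneg (hf : IsUnitPeakDensity f) (x : ℝ) : 0 ≤ f x := hf.logConcave.1 x

theorem le_one (hf : IsUnitPeakDensity f) (x : ℝ) : f x ≤ 1 :=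
  hf.apply_zero ▸ hf.logConcave.le_apply_zero hf.symm x

theorem anti (hf : IsUnitPeakDensity f) {x y : ℝ} (h : |y| ≤ |x|) : f x ≤ f y :=
  hf.logConcave.apply_le_of_abs_le hf.symm h

theorem measurable (hf : IsUnitPeakDensity f) : Measurable f := hf.logConcave.measurable hf.symm

theorem setIntegral_le_one (hf : IsUnitPeakDensity f) (s : Set ℝ) : ∫ x in s, f x ≤ 1 :=
  hf.integral_eq_one ▸ setIntegral_le_integral hf.integrable (ae_of_all _ hf.nonneg)

theorem setIntegral_Icc_le (hf : IsUnitPeakDensity f) {a b : ℝ} (hab : a ≤ b) :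
    ∫ x in Set.Icc a b, f x ≤ b - a := by
  calc ∫ x in Set.Icc a b, f x ≤ ∫ _ in Set.Icc a b, (1 : ℝ) :=
        setIntegral_mono hf.integrable.integrableOn
          (integrableOn_const (by simp) (by simp)) hf.le_one
    _ = b - a := by simp [hab]

/-- By monotonicity in `|x|`, the mass of `[-1, 1]` is at least `2 * f 1`. -/
theorem apply_one_le (hf : IsUnitPeakDensity f) : f 1 ≤ 1 / 2 := by
  have h : ∫ _ in Set.Icc (-1 : ℝ) 1, f 1 ≤ ∫ x in Set.Icc (-1 : ℝ) 1, f x :=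
    setIntegral_mono_on (integrableOn_const (by simp) (by simp)) hf.integrable.integrableOn
      measurableSet_Icc fun x hx => hf.anti (by rw [abs_one]; exact abs_le.2 hx)
  have h2 := hf.setIntegral_le_one (Set.Icc (-1) 1)
  simp at h
  norm_num at h
  linarith

theorem integrable_sq_mul (hf : IsUnitPeakDensity f) : Integrable fun x => x ^ 2 * f x := by
  refine (integrable_inv_one_add_sq.const_mul 784).mono'
    ((measurable_id.pow_const 2).mul hf.measurable).aestronglyMeasurable (ae_of_all _ fun x => ?_)
  rw [Real.norm_eq_abs, abs_of_nonneg (mul_nonneg (sq_nonneg x) (hf.nonneg x))]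
  exact hf.logConcave.sq_mul_le hf.symm hf.apply_zero hf.apply_one_le x

theorem integral_sq_mul_le (hf : IsUnitPeakDensity f) : ∫ x, x ^ 2 * f x ≤ 56 ^ 2 := by
  calc ∫ x, x ^ 2 * f x ≤ ∫ x, 784 * (1 + x ^ 2)⁻¹ :=
        integral_mono hf.integrable_sq_mul (integrable_inv_one_add_sq.const_mul 784)
          fun x => hf.logConcave.sq_mul_le hf.symm hf.apply_zero hf.apply_one_le x
    _ = 784 * Real.pi := by rw [integral_const_mul, integral_univ_inv_one_add_sq]
    _ ≤ 56 ^ 2 := by linarith [Real.pi_le_four]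

/-- `[-1/4, 1/4]` has mass at most `1/2` since `f ≤ 1`, and Chebyshev leaves at most `56² / 112² =
1/4` outside `[-112, 112]`. The remaining mass, at least `1/4`, sits where `f ≤ f (1/4)`, on a set
of length at most `224`. -/
theorem le_apply_quarter (hf : IsUnitPeakDensity f) : 1 / 896 ≤ f (1 / 4) := by
  have hi : ∀ x : ℝ, f x ≤ (Set.Icc (-(1 / 4)) (1 / 4)).indicator f x
      + (Set.Icc (-112) 112).indicator (fun _ => f (1 / 4)) x + 1 / 12544 * (x ^ 2 * f x) := by
    intro x
    have h0 := hf.nonneg x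
    have hsq : 0 ≤ 1 / 12544 * (x ^ 2 * f x) := by positivity
    have h1 : 0 ≤ (Set.Icc (-112 : ℝ) 112).indicator (fun _ => f (1 / 4)) x :=
      Set.indicator_nonneg (fun _ _ => hf.nonneg _) x
    by_cases hx : x ∈ Set.Icc (-(1 / 4) : ℝ) (1 / 4)
    · rw [Set.indicator_of_mem hx]; linarith
    rw [Set.indicator_of_notMem hx, zero_add]
    by_cases hx2 : x ∈ Set.Icc (-112 : ℝ) 112
    · rw [Set.indicator_of_mem hx2]
      have : f x ≤ f (1 / 4) := hf.anti (by
        rw [abs_of_pos (by norm_num : (0 : ℝ) < 1 / 4)]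
        by_contra! h
        exact hx (abs_le.1 h.le))
      linarith
    · rw [Set.indicator_of_notMem hx2, zero_add]
      have : (112 : ℝ) < |x| := by
        by_contra! h
        exact hx2 (abs_le.1 h)
      have : (12544 : ℝ) ≤ x ^ 2 := by
        rw [← sq_abs]; nlinarith
      nlinarith
  have i1 : Integrable ((Set.Icc (-(1 / 4) : ℝ) (1 / 4)).indicator f) :=
    hf.integrable.indicator measurableSet_Icc
  have i2 : Integrable ((Set.Icc (-112 : ℝ) 112).indicator fun _ => f (1 / 4)) :=
    (integrable_indicator_iff measurableSet_Icc).2 (integrableOn_const (by simp) (by simp))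
  have i3 := hf.integrable_sq_mul.const_mul (1 / 12544)
  have i12 : Integrable fun x => (Set.Icc (-(1 / 4) : ℝ) (1 / 4)).indicator f x
      + (Set.Icc (-112 : ℝ) 112).indicator (fun _ => f (1 / 4)) x := i1.add i2
  have h := integral_mono hf.integrable (i12.add i3) hi
  rw [hf.integral_eq_one, integral_add' i12 i3, integral_add i1 i2, integral_const_mul,
    integral_indicator measurableSet_Icc, integral_indicator measurableSet_Icc] at h
  have h1 := hf.setIntegral_Icc_le (a := -(1 / 4)) (b := 1 / 4) (by norm_num)
  have h2 := hf.integral_sq_mul_le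
  have h3 : ∫ _ in Set.Icc (-112 : ℝ) 112, f (1 / 4) = 224 * f (1 / 4) := by
    simp; norm_num
  rw [h3] at h
  linarith

/-- Unimodality gives the difference a constant sign on each half-line, so the integral telescopes
to twice the mass of `[-k, k]`. -/
theorem integral_abs_sub_le (hf : IsUnitPeakDensity f) {k : ℝ} (hk : 0 ≤ k) :
    ∫ x, |f (x - k) - f (x + k)| ≤ 4 * k := by
  have heven : ∀ x, |f (x - k) - f (x + k)| = f (|x| - k) - f (|x| + k) := by
    intro x
    have hD : 0 ≤ f (|x| - k) - f (|x| + k) := by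
      refine sub_nonneg.2 (hf.anti ?_)
      rw [abs_of_nonneg (by positivity : 0 ≤ |x| + k)]
      exact abs_le.2 ⟨by linarith [abs_nonneg x], by linarith⟩
    rcases abs_choice x with h | h
    · rw [h] at hD ⊢; exact abs_of_nonneg hD
    · rw [h] at hD ⊢
      have e1 : f (-x - k) = f (x + k) := by rw [← hf.symm]; congr 1; ring
      have e2 : f (-x + k) = f (x - k) := by rw [← hf.symm]; congr 1; ring
      rw [e1, e2] at hD ⊢
      rw [abs_sub_comm]; exact abs_of_nonneg hD
  simp_rw [heven]
  rw [integral_comp_abs (f := fun x => f (x - k) - f (x + k)),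
    integral_sub (hf.integrable.comp_sub_right k).integrableOn
      (hf.integrable.comp_add_right k).integrableOn]
  have e1 : ∫ x in Set.Ioi (0 : ℝ), f (x - k) = ∫ x in Set.Ioi (-k), f x := by
    rw [← integral_indicator measurableSet_Ioi, ← integral_indicator measurableSet_Ioi,
      ← integral_sub_right_eq_self ((Set.Ioi (-k)).indicator _) k]
    congr 1
    ext x
    simp [Set.indicator_apply]
  have e2 : ∫ x in Set.Ioi (0 : ℝ), f (x + k) = ∫ x in Set.Ioi k, f x := by
    rw [← integral_indicator measurableSet_Ioi, ← integral_indicator measurableSet_Ioi,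
      ← integral_add_right_eq_self ((Set.Ioi k).indicator _) k]
    congr 1
    ext x
    simp [Set.indicator_apply]
  have e3 : ∫ x in Set.Ioi (-k), f x
      = (∫ x in Set.Ioc (-k) k, f x) + ∫ x in Set.Ioi k, f x := by
    rw [← setIntegral_union (Set.Ioc_disjoint_Ioi le_rfl) measurableSet_Ioi
      hf.integrable.integrableOn hf.integrable.integrableOn,
      Set.Ioc_union_Ioi_eq_Ioi (by linarith)]
  have h := hf.setIntegral_Icc_le (a := -k) (b := k) (by linarith)
  rw [integral_Icc_eq_integral_Ioc] at h
  rw [e1, e2, e3]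
  linarith

/-- Translations by `± k`, a quarter period, multiply the transform by `± i`. Their difference
therefore has twice its modulus, and is bounded by the `L¹` modulus of continuity. -/
theorem norm_fourier_mul_le (hf : IsUnitPeakDensity f) {s : ℝ} (hs : s ≠ 0) :
    ‖∫ x : ℝ, (f x : ℂ) * Complex.exp (x * s * Complex.I)‖ ≤ 4 / |s| := by
  set φ := ∫ x : ℝ, (f x : ℂ) * Complex.exp (x * s * Complex.I) with hφ
  set k := Real.pi / (2 * |s|) with hk
  have hs' : 0 < |s| := abs_pos.2 hs
  have hk0 : 0 ≤ k := by positivity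
  have hshift : ∀ r : ℝ, φ * Complex.exp (r * s * Complex.I)
      = ∫ x : ℝ, (f (x - r) : ℂ) * Complex.exp (x * s * Complex.I) := by
    intro r
    rw [hφ, ← integral_mul_const,
      ← integral_sub_right_eq_self (fun x : ℝ => (f x : ℂ) * Complex.exp (x * s * Complex.I)
        * Complex.exp (r * s * Complex.I)) r]
    congr 1
    ext x
    rw [mul_assoc, ← Complex.exp_add]
    congr 2
    push_cast
    ring
  have hint : ∀ r : ℝ,
      Integrable fun x : ℝ => (f (x - r) : ℂ) * Complex.exp (x * s * Complex.I) := by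
    intro r
    refine (hf.integrable.comp_sub_right r).ofReal.mul_bdd (c := 1) (by fun_prop)
      (ae_of_all _ fun x => ?_)
    rw [← Complex.ofReal_mul, Complex.norm_exp_ofReal_mul_I]
  have hdiff : φ * (Complex.exp (k * s * Complex.I) - Complex.exp ((-k : ℝ) * s * Complex.I))
      = ∫ x : ℝ, ((f (x - k) - f (x + k) : ℝ) : ℂ) * Complex.exp (x * s * Complex.I) := by
    rw [mul_sub, hshift, hshift, ← integral_sub (hint k) (hint (-k))]
    congr 1
    ext x
    rw [sub_neg_eq_add]
    push_cast
    ring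
  have hexp : ‖Complex.exp (k * s * Complex.I) - Complex.exp ((-k : ℝ) * s * Complex.I)‖ = 2 := by
    have h1 : |k * s| = Real.pi / 2 := by
      rw [abs_mul, abs_of_nonneg hk0, hk]; field_simp
    have h2 : Complex.exp (k * s * Complex.I) - Complex.exp ((-k : ℝ) * s * Complex.I)
        = 2 * Complex.I * (Real.sin (k * s) : ℝ) := by
      have e1 : (k : ℂ) * s * Complex.I = (k * s : ℝ) * Complex.I := by push_cast; ring
      have e2 : ((-k : ℝ) : ℂ) * s * Complex.I = (-(k * s) : ℝ) * Complex.I := by push_cast; ring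
      rw [e1, e2, Complex.exp_mul_I, Complex.exp_mul_I, ← Complex.ofReal_cos, ← Complex.ofReal_sin,
        ← Complex.ofReal_cos, ← Complex.ofReal_sin, Real.cos_neg, Real.sin_neg]
      push_cast
      ring
    have h3 : |Real.sin (k * s)| = 1 := by
      rcases abs_choice (k * s) with h | h
      · rw [h] at h1; rw [h1, Real.sin_pi_div_two, abs_one]
      · rw [h] at h1
        rw [← abs_neg, ← Real.sin_neg, h1, Real.sin_pi_div_two, abs_one]
    rw [h2, norm_mul, norm_mul, Complex.norm_I, Complex.norm_real, Real.norm_eq_abs, h3]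
    norm_num
  have hbound : ‖φ‖ * 2 ≤ 4 * k := by
    rw [← hexp, ← norm_mul, hdiff]
    refine le_trans (norm_integral_le_integral_norm _) (le_trans (le_of_eq ?_)
      (hf.integral_abs_sub_le hk0))
    congr 1
    ext x
    rw [norm_mul, ← Complex.ofReal_mul, Complex.norm_exp_ofReal_mul_I, mul_one, Complex.norm_real,
      Real.norm_eq_abs]
  calc ‖φ‖ ≤ 2 * k := by linarith
    _ = Real.pi / |s| := by rw [hk]; field_simp
    _ ≤ 4 / |s| := by gcongr; exact Real.pi_le_four

end IsUnitPeakDensity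

/-! ### Low frequencies: comparison with a uniform component -/

theorem abs_sin_le_mul_one_sub_of_abs_le_one {y : ℝ} (hy : |y| ≤ 1) :
    |Real.sin y| ≤ |y| * (1 - y ^ 2 / 10) := by
  have main : ∀ z : ℝ, 0 ≤ z → z ≤ 1 → |Real.sin z| ≤ z * (1 - z ^ 2 / 10) := by
    intro z hz0 hz1
    rw [abs_of_nonneg (Real.sin_nonneg_of_nonneg_of_le_pi hz0 (by linarith [Real.pi_gt_three]))]
    have h := (abs_le.1 (Real.sin_bound (x := z) (by rwa [abs_of_nonneg hz0]))).2
    rw [abs_of_nonneg hz0] at h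
    have h4 : z ^ 4 ≤ z ^ 3 := pow_le_pow_of_le_one hz0 hz1 (by norm_num)
    have h3 : 0 ≤ z ^ 3 := by positivity
    nlinarith
  have h := main |y| (abs_nonneg y) hy
  rw [sq_abs] at h
  rcases abs_choice y with e | e
  · rwa [e] at h ⊢
  · rw [e, Real.sin_neg, abs_neg] at h
    rwa [e]

theorem abs_sin_le_mul_one_sub_min (y : ℝ) :
    |Real.sin y| ≤ |y| * (1 - min 1 (y ^ 2) / 40) := by
  have h0 := abs_nonneg y
  rcases le_or_gt |y| 2 with hy | hy
  · have h := abs_sin_le_mul_one_sub_of_abs_le_one (y := y / 2)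
      (by rw [abs_div, abs_two]; linarith)
    have e : Real.sin y = 2 * Real.sin (y / 2) * Real.cos (y / 2) := by
      rw [← Real.sin_two_mul]; congr 1; ring
    have h2 : |Real.sin y| ≤ 2 * |Real.sin (y / 2)| := by
      rw [e, abs_mul, abs_mul, abs_two]
      exact mul_le_of_le_one_right (by positivity) (Real.abs_cos_le_one _)
    rw [abs_div, abs_two, div_pow] at h
    have h3 : min 1 (y ^ 2) ≤ y ^ 2 := min_le_right _ _
    calc |Real.sin y| ≤ |y| * (1 - y ^ 2 / 40) := by linarith
      _ ≤ _ := by gcongr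
  · have h3 : min 1 (y ^ 2) ≤ 1 := min_le_left _ _
    have := Real.abs_sin_le_one y
    nlinarith

theorem norm_integral_Icc_exp_le (s : ℝ) :
    ‖∫ x in Set.Icc (-(1 / 4) : ℝ) (1 / 4), Complex.exp (x * s * Complex.I)‖
      ≤ 1 / 2 * (1 - min 1 ((s / 4) ^ 2) / 40) := by
  rcases eq_or_ne s 0 with rfl | hs
  · simp; norm_num
  have hsC : (s : ℂ) * Complex.I ≠ 0 := by simp [hs]
  have e : ∫ x in Set.Icc (-(1 / 4) : ℝ) (1 / 4), Complex.exp (x * s * Complex.I)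
      = ((2 * Real.sin (s / 4) / s : ℝ) : ℂ) := by
    rw [integral_Icc_eq_integral_Ioc, ← intervalIntegral.integral_of_le (by norm_num)]
    have : ∀ x : ℝ, (x : ℂ) * s * Complex.I = (s * Complex.I) * x := fun x => by ring
    simp_rw [this]
    rw [integral_exp_mul_complex hsC]
    have e1 : (s : ℂ) * Complex.I * (1 / 4 : ℝ) = (s / 4 : ℝ) * Complex.I := by push_cast; ring
    have e2 : (s : ℂ) * Complex.I * (-(1 / 4) : ℝ) = (-(s / 4) : ℝ) * Complex.I := by
      push_cast; ring
    rw [e1, e2, Complex.exp_mul_I, Complex.exp_mul_I, ← Complex.ofReal_cos, ← Complex.ofReal_sin,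
      ← Complex.ofReal_cos, ← Complex.ofReal_sin, Real.cos_neg, Real.sin_neg,
      div_eq_iff hsC]
    have : (s : ℂ) ≠ 0 := by exact_mod_cast hs
    push_cast
    field_simp
    ring
  have h := abs_sin_le_mul_one_sub_min (s / 4)
  have hs' : 0 < |s| := abs_pos.2 hs
  rw [e, Complex.norm_real, Real.norm_eq_abs, abs_div, abs_mul, abs_two, div_le_iff₀ hs']
  rw [abs_div, abs_of_pos (by norm_num : (0 : ℝ) < 4)] at h
  linarith

namespace IsUnitPeakDensity

variable {f : ℝ → ℝ}

/-- The density dominates `1/896` on `[-1/4, 1/4]`. This uniform component of mass `1/1792` has an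
explicit sine transform that falls short of its mass; the rest is bounded trivially. The constant is
`71680 = 1792 * 40`. -/
theorem norm_fourier_le_one_sub (hf : IsUnitPeakDensity f) (s : ℝ) :
    ‖∫ x : ℝ, (f x : ℂ) * Complex.exp (x * s * Complex.I)‖
      ≤ 1 - min 1 ((s / 4) ^ 2) / 71680 := by
  set S : Set ℝ := Set.Icc (-(1 / 4)) (1 / 4) with hS
  have hSm : MeasurableSet S := measurableSet_Icc
  set u : ℝ → ℝ := S.indicator fun _ => (1 / 896 : ℝ) with hu
  have hui : Integrable u :=
    (integrable_indicator_iff hSm).2 (integrableOn_const (by simp [hS]) (by simp))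
  have hle : ∀ x, u x ≤ f x := by
    intro x
    by_cases hx : x ∈ S
    · rw [hu, Set.indicator_of_mem hx]
      refine hf.le_apply_quarter.trans (hf.anti ?_)
      rw [abs_of_pos (by norm_num : (0 : ℝ) < 1 / 4)]
      exact abs_le.2 hx
    · rw [hu, Set.indicator_of_notMem hx]
      exact hf.nonneg x
  have huint : ∫ x, u x = 1 / 1792 := by
    rw [hu, integral_indicator hSm]
    simp [hS]
    norm_num
  have hnorm : ∀ x : ℝ, ‖Complex.exp (x * s * Complex.I)‖ = 1 := fun x => by
    rw [← Complex.ofReal_mul, Complex.norm_exp_ofReal_mul_I]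
  have hint : ∀ {g : ℝ → ℝ}, Integrable g →
      Integrable fun x : ℝ => (g x : ℂ) * Complex.exp (x * s * Complex.I) := fun hg =>
    hg.ofReal.mul_bdd (c := 1) (by fun_prop) (ae_of_all _ fun x => (hnorm x).le)
  have hsplit : ∫ x : ℝ, (f x : ℂ) * Complex.exp (x * s * Complex.I)
      = (∫ x : ℝ, ((f x - u x : ℝ) : ℂ) * Complex.exp (x * s * Complex.I))
        + ∫ x : ℝ, (u x : ℂ) * Complex.exp (x * s * Complex.I) := by
    rw [← integral_add (hint (g := fun x => f x - u x) (hf.integrable.sub hui)) (hint hui)]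
    congr 1
    ext x
    push_cast
    ring
  have h1 : ‖∫ x : ℝ, ((f x - u x : ℝ) : ℂ) * Complex.exp (x * s * Complex.I)‖
      ≤ 1 - 1 / 1792 := by
    rw [← huint, ← hf.integral_eq_one, ← integral_sub hf.integrable hui]
    refine norm_integral_le_of_norm_le (hf.integrable.sub hui) (ae_of_all _ fun x => ?_)
    rw [norm_mul, hnorm, mul_one, Complex.norm_real, Real.norm_eq_abs,
      abs_of_nonneg (sub_nonneg.2 (hle x))]
  have h2 : ∫ x : ℝ, (u x : ℂ) * Complex.exp (x * s * Complex.I)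
      = (1 / 896 : ℝ) * ∫ x in S, Complex.exp (x * s * Complex.I) := by
    rw [← integral_const_mul, ← integral_indicator hSm]
    congr 1
    ext x
    by_cases hx : x ∈ S <;> simp [hu, hx]
  have h3 := norm_integral_Icc_exp_le s
  rw [hsplit, h2]
  refine (norm_add_le _ _).trans ?_
  rw [norm_mul, Complex.norm_real, Real.norm_eq_abs, abs_of_pos (by norm_num : (0 : ℝ) < 1 / 896)]
  linarith

/-- The low-frequency deficit serves for `|s| ≤ 12`, and the bound `4 / |s|` beyond. The scale
`1/4000` is small enough that the constant deficit on `4 < |s| ≤ 12` still wins. -/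
theorem norm_fourier_sq_le (hf : IsUnitPeakDensity f) (s : ℝ) :
    ‖∫ x : ℝ, (f x : ℂ) * Complex.exp (x * s * Complex.I)‖ ^ 2
      ≤ (1 + (1 / 4000 * s) ^ 2)⁻¹ := by
  have h1 := hf.norm_fourier_le_one_sub s
  have h2 : s ≠ 0 → _ := fun h => hf.norm_fourier_mul_le h
  set m := ‖∫ x : ℝ, (f x : ℂ) * Complex.exp (x * s * Complex.I)‖ with hm
  have hm0 : 0 ≤ m := norm_nonneg _
  have hmin : 0 ≤ min 1 ((s / 4) ^ 2) := by positivity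
  have hm1 : m ≤ 1 := by linarith
  have hmm : m ^ 2 ≤ m := by nlinarith
  rw [← one_div, le_div_iff₀ (by positivity)]
  have hs2 : 0 ≤ s ^ 2 := sq_nonneg s
  rcases le_or_gt (s ^ 2) 16 with hs | hs
  · rw [min_eq_right (by linarith)] at h1
    have : m ^ 2 ≤ 1 - (s / 4) ^ 2 / 71680 := hmm.trans h1
    calc m ^ 2 * (1 + (1 / 4000 * s) ^ 2)
        ≤ (1 - (s / 4) ^ 2 / 71680) * (1 + (1 / 4000 * s) ^ 2) := by gcongr
      _ ≤ 1 := by nlinarith [mul_nonneg hs2 hs2]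
  rcases le_or_gt (s ^ 2) 144 with hs' | hs'
  · rw [min_eq_left (by linarith)] at h1
    calc m ^ 2 * (1 + (1 / 4000 * s) ^ 2)
        ≤ (1 - 1 / 71680) * (1 + (1 / 4000) ^ 2 * 144) := by
          rw [mul_pow]
          gcongr
          exact hmm.trans h1
      _ ≤ 1 := by norm_num
  · have hs0 : s ≠ 0 := by rintro rfl; norm_num at hs
    have h := h2 hs0
    have hsq : m ^ 2 * s ^ 2 ≤ 16 := by
      rw [le_div_iff₀ (abs_pos.2 hs0)] at h
      rw [← sq_abs s, ← mul_pow]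
      have : 0 ≤ m * |s| := by positivity
      nlinarith
    have h3 : m ^ 2 * 144 ≤ 16 := le_trans (by gcongr) hsq
    nlinarith

end IsUnitPeakDensity

/-! ### Laws with a density and normalisation of the peak -/

section law

variable {f : ℝ → ℝ}

theorem integral_withDensity_ofReal {E : Type*} [NormedAddCommGroup E] [NormedSpace ℝ E]
    (hm : Measurable f) (h0 : ∀ x, 0 ≤ f x) (g : ℝ → E) :
    ∫ x, g x ∂(volume.withDensity fun x => ENNReal.ofReal (f x)) = ∫ x, f x • g x := by
  rw [integral_withDensity_eq_integral_toReal_smul hm.ennreal_ofReal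
    (ae_of_all _ fun x => ENNReal.ofReal_lt_top)]
  simp [ENNReal.toReal_ofReal (h0 _)]

theorem map_mul_withDensity_ofReal (hm : Measurable f) {M : ℝ} (hM : 0 < M) :
    (volume.withDensity fun x => ENNReal.ofReal (f x)).map (M * ·)
      = volume.withDensity fun x => ENNReal.ofReal (f (x / M) / M) := by
  have hg : Measurable fun x => ENNReal.ofReal (f (x / M) / M) := by fun_prop
  have hmul : Measurable (M * · : ℝ → ℝ) := by fun_prop
  ext s hs
  rw [Measure.map_apply hmul hs, withDensity_apply _ (hmul hs), withDensity_apply _ hs]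
  conv_rhs => rw [← Real.smul_map_volume_mul_left hM.ne']
  rw [Measure.restrict_smul, lintegral_smul_measure, setLIntegral_map hs hg hmul, smul_eq_mul,
    ← lintegral_const_mul _ (by fun_prop)]
  refine lintegral_congr fun x => ?_
  rw [abs_of_pos hM, ← ENNReal.ofReal_mul hM.le, mul_div_cancel_left₀ _ hM.ne']
  congr 1
  field_simp

theorem IsLogConcave.apply_zero_pos (hf : IsLogConcave f) (hs : ∀ x, f (-x) = f x)
    [IsProbabilityMeasure (volume.withDensity fun x => ENNReal.ofReal (f x))] : 0 < f 0 := by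
  refine (hf.1 0).lt_of_ne fun h => ?_
  have hz : (fun x => ENNReal.ofReal (f x)) = 0 := by
    ext x
    have := hf.le_apply_zero hs x
    simp only [Pi.zero_apply, ENNReal.ofReal_eq_zero]
    linarith
  have := measure_univ (μ := volume.withDensity fun x => ENNReal.ofReal (f x))
  rw [hz, withDensity_zero] at this
  simp at this

theorem IsLogConcave.div_comp_div (hf : IsLogConcave f) {M : ℝ} (hM : 0 < M) :
    IsLogConcave fun x => f (x / M) / M := by
  refine ⟨fun x => div_nonneg (hf.1 _) hM.le, fun x y a b ha hb hab => ?_⟩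
  have h := hf.2 (x / M) (y / M) a b ha hb hab
  have e : (a * x + b * y) / M = a * (x / M) + b * (y / M) := by ring
  have hMM : M ^ a * M ^ b = M := by rw [← Real.rpow_add hM, hab, Real.rpow_one]
  beta_reduce
  rw [e, Real.div_rpow (hf.1 _) hM.le, Real.div_rpow (hf.1 _) hM.le, div_mul_div_comm, hMM]
  gcongr

/-- Normalising the peak of a symmetric log-concave probability density. -/
theorem IsLogConcave.isUnitPeakDensity_div_comp_div (hf : IsLogConcave f)
    (hs : ∀ x, f (-x) = f x)
    [IsProbabilityMeasure (volume.withDensity fun x => ENNReal.ofReal (f x))] :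
    IsUnitPeakDensity fun x => f (x / f 0) / f 0 := by
  have hM := hf.apply_zero_pos hs
  have hlc := hf.div_comp_div hM
  have hsym : ∀ x, f (-x / f 0) / f 0 = f (x / f 0) / f 0 := fun x => by rw [neg_div, hs]
  have hmeas : Measurable fun x => f (x / f 0) / f 0 := hlc.measurable hsym
  have hp : IsProbabilityMeasure
      (volume.withDensity fun x => ENNReal.ofReal (f (x / f 0) / f 0)) := by
    rw [← map_mul_withDensity_ofReal (hf.measurable hs) hM]
    exact Measure.isProbabilityMeasure_map (by fun_prop)
  have hl : ∫⁻ x, ENNReal.ofReal (f (x / f 0) / f 0) = 1 := by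
    have := hp.measure_univ
    rwa [withDensity_apply _ MeasurableSet.univ, Measure.restrict_univ] at this
  have hnn : 0 ≤ᵐ[volume] fun x => f (x / f 0) / f 0 := ae_of_all _ hlc.1
  refine ⟨hlc, hsym, by simp [hM.ne'], ⟨hmeas.aestronglyMeasurable, ?_⟩, ?_⟩
  · rw [hasFiniteIntegral_iff_ofReal hnn, hl]
    exact ENNReal.one_lt_top
  · rw [integral_eq_lintegral_of_nonneg_ae hnn hmeas.aestronglyMeasurable, hl, ENNReal.toReal_one]

end law

namespace IsUnitPeakDensity

variable {f : ℝ → ℝ}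

theorem memLp_id (hf : IsUnitPeakDensity f) :
    MemLp id 2 (volume.withDensity fun x => ENNReal.ofReal (f x)) := by
  rw [memLp_two_iff_integrable_sq (by fun_prop),
    integrable_withDensity_iff hf.measurable.ennreal_ofReal
      (ae_of_all _ fun x => ENNReal.ofReal_lt_top)]
  simpa [ENNReal.toReal_ofReal (hf.nonneg _)] using hf.integrable_sq_mul

theorem integral_id_eq_zero (hf : IsUnitPeakDensity f) :
    ∫ x, x ∂(volume.withDensity fun x => ENNReal.ofReal (f x)) = 0 := by
  rw [integral_withDensity_ofReal hf.measurable hf.nonneg]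
  have h := integral_neg_eq_self (fun x => f x • x) volume
  simp only [hf.symm, smul_neg, integral_neg] at h
  linarith

theorem integral_sq_le (hf : IsUnitPeakDensity f) :
    ∫ x, x ^ 2 ∂(volume.withDensity fun x => ENNReal.ofReal (f x)) ≤ 56 ^ 2 := by
  rw [integral_withDensity_ofReal hf.measurable hf.nonneg]
  simp_rw [smul_eq_mul, mul_comm (f _)]
  exact hf.integral_sq_mul_le

theorem measureReal_abs_add_le (hf : IsUnitPeakDensity f) (u : ℝ) {t : ℝ} (ht : 0 ≤ t) :
    (volume.withDensity fun x => ENNReal.ofReal (f x)).real {x | |x + u| ≤ t} ≤ 2 * t := by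
  have hset : {x : ℝ | |x + u| ≤ t} = Set.Icc (-t - u) (t - u) := by
    ext x
    simp only [Set.mem_ofPred_eq, Set.mem_Icc, abs_le]
    constructor <;> rintro ⟨h1, h2⟩ <;> constructor <;> linarith
  have h := hf.setIntegral_Icc_le (a := -t - u) (b := t - u) (by linarith)
  rw [hset, Measure.real, withDensity_apply _ measurableSet_Icc,
    ← integral_eq_lintegral_of_nonneg_ae (ae_of_all _ hf.nonneg)
      hf.measurable.aestronglyMeasurable]
  linarith

theorem norm_charFun_sq_le (hf : IsUnitPeakDensity f) (s : ℝ) :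
    ‖charFun (volume.withDensity fun x => ENNReal.ofReal (f x)) s‖ ^ 2
      ≤ (1 + (1 / 4000 * s) ^ 2)⁻¹ := by
  have h := hf.norm_fourier_sq_le s
  rw [charFun_apply_real, integral_withDensity_ofReal hf.measurable hf.nonneg]
  simp_rw [Complex.real_smul, mul_comm (s : ℂ)]
  exact h

end IsUnitPeakDensity

/-! ### The comparison inequality for log-concave densities -/

theorem mainTheorem2 :
    ∃ C : ℝ, 0 < C ∧
      ∀ (f : ℝ → ℝ), IsLogConcave f → (∀ x, f (-x) = f x) →
      ∀ (Ω : Type*) [MeasurableSpace Ω] (P : Measure Ω) [IsProbabilityMeasure P]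
        (n : ℕ) (X : Fin n → Ω → ℝ),
        (∀ i, HasLaw (X i) (volume.withDensity fun x => ENNReal.ofReal (f x)) P) →
        iIndepFun X P →
        ∀ α β : EuclideanSpace ℝ (Fin n), α ≠ 0 →
          P.real {ω | |∑ i, α i * X i ω| ≤ |∑ i, β i * X i ω|} ≤ C * (‖β‖ / ‖α‖) := by
  -- The constant of `measureReal_abs_sum_le_abs_sum` at `K = 56`, `c = 1 / 4000`.
  refine ⟨4 + 24 * 56 + 128 * 56 / (1 / 4000), by norm_num, ?_⟩
  intro f hf hs Ω _ P _ n X hlaw hX α β hα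
  -- That `f` has total mass one is read off from the law of some `X i`; an index exists because `α
  -- ≠ 0`.
  have hn : Nonempty (Fin n) := by
    by_contra h
    rw [not_nonempty_iff] at h
    exact hα (Subsingleton.elim _ _)
  have hp : IsProbabilityMeasure (volume.withDensity fun x => ENNReal.ofReal (f x)) :=
    (hlaw hn.some).isProbabilityMeasure_iff.1 inferInstance
  have hM := hf.apply_zero_pos hs
  have hg := hf.isUnitPeakDensity_div_comp_div hs
  have hlaw' : ∀ i, HasLaw (fun ω => f 0 * X i ω)
      (volume.withDensity fun x => ENNReal.ofReal (f (x / f 0) / f 0)) P := fun i =>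
    HasLaw.fun_comp (Y := (f 0 * ·))
      ⟨by fun_prop, map_mul_withDensity_ofReal (hf.measurable hs) hM⟩ (hlaw i)
  have hX' : iIndepFun (fun i ω => f 0 * X i ω) P :=
    hX.comp (fun _ x => f 0 * x) fun _ => by fun_prop
  have h := measureReal_abs_sum_le_abs_sum hX' hlaw' hg.memLp_id hg.integral_id_eq_zero
    hg.integral_sq_le (by norm_num) (fun u t ht => hg.measureReal_abs_add_le u ht)
    (by norm_num) hg.norm_charFun_sq_le α β hα
  have hset : {ω | |∑ i, α i * (f 0 * X i ω)| ≤ |∑ i, β i * (f 0 * X i ω)|}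
      = {ω | |∑ i, α i * X i ω| ≤ |∑ i, β i * X i ω|} := by
    ext ω
    simp only [Set.mem_ofPred_eq, mul_left_comm _ (f 0), ← Finset.mul_sum, abs_mul]
    exact mul_le_mul_iff_right₀ (abs_pos.2 hM.ne')
  rwa [hset] at h
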